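/- Let $(G_i)_{i\in I}$ be a family of finite groups, and let $G=\bigoplus_{i\in I}G_i$ be its restricted direct product, that is, the group of all $(x_i)_{i\in I}\in\prod_{i\in I} G_i$ such that $x_i=e_{G_i}$ for all but finitely many $i$. Suppose that $G$ is infinite. Let $\mathrm{Z}\ell^1(G)$ be the centre of the convolution algebra $\ell^1(G)$, with the $\ell^1$-norm, and let $\omega$ be an algebra character of $\mathrm{Z}\ell^1(G)$, that is, a non-zero multiplicative linear functional on $\mathrm{Z}\ell^1(G)$. Let $\widetilde\omega:G\to\mathbb{C}$ be the corresponding class function, that is, the function, constant on conjugacy classes, given by $\widetilde\omega(x)=\omega(1_C)/|C|$, where $C$ is the (finite) conjugacy class of $x^{-1}$; equivalently, $\omega(f)=\sum_{x\in G}f(x)\,\widetilde\omega(x^{-1})$ for all $f\in \mathrm{Z}\ell^1(G)$. If the ideal $\ker\omega$ has a bounded approximate identity, then $\omega$ does not lie in $c_0$, that is, $\widetilde\omega\notin c_0(G)$. Equivalently: there is no algebra character $\omega$ of $\mathrm{Z}\ell^1(G)$ for which $\ker\omega$ has a bounded approximate identity and $\widetilde\omega\in c_0(G)$. -/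

import Mathlib

open Filter Topology
open scoped RestrictedProduct lp

/-- The underlying space of the group algebra `ℓ¹(G)` of a discrete group `G`: the Banach space of
absolutely summable functions `G → ℂ`. (A type synonym, so that it can carry convolution.) -/
def L1 (G : Type*) : Type _ := ℓ¹(G, ℂ)

namespace L1

noncomputable section

section Space

variable {G : Type*}

instance : NormedAddCommGroup (L1 G) := inferInstanceAs (NormedAddCommGroup ℓ¹(G, ℂ))
instance : NormedSpace ℂ (L1 G) := inferInstanceAs (NormedSpace ℂ ℓ¹(G, ℂ))
instance : CompleteSpace (L1 G) := inferInstanceAs (CompleteSpace ℓ¹(G, ℂ))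

instance : FunLike (L1 G) G ℂ where
  coe f := f.1
  coe_injective _ _ h := Subtype.ext h

@[ext]
theorem ext {f g : L1 G} (h : ∀ x, f x = g x) : f = g := DFunLike.ext _ _ h

/-- An absolutely summable function, as an element of `ℓ¹(G)`. -/
def mk (f : G → ℂ) (hf : Summable fun x => ‖f x‖) : L1 G :=
  ⟨f, memℓp_gen (by simpa using hf)⟩

@[simp] theorem mk_apply (f : G → ℂ) (hf : Summable fun x => ‖f x‖) (x : G) : mk f hf x = f x := rfl
@[simp] theorem add_apply (f g : L1 G) (x : G) : (f + g) x = f x + g x := rfl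
@[simp] theorem zero_apply (x : G) : (0 : L1 G) x = 0 := rfl
@[simp] theorem smul_apply (c : ℂ) (f : L1 G) (x : G) : (c • f) x = c * f x := rfl

theorem summable_norm (f : L1 G) : Summable fun x => ‖f x‖ := by
  have h := (lp.memℓp (show ℓ¹(G, ℂ) from f)).summable (by simp)
  simp only [ENNReal.toReal_one, Real.rpow_one] at h
  exact h

theorem norm_eq (f : L1 G) : ‖f‖ = ∑' x, ‖f x‖ := by
  have h := lp.norm_eq_tsum_rpow (p := 1) (by simp) (show ℓ¹(G, ℂ) from f)
  simp only [ENNReal.toReal_one, Real.rpow_one, div_one] at h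
  exact h

theorem norm_apply_le (f : L1 G) (x : G) : ‖f x‖ ≤ ‖f‖ := by
  rw [norm_eq]
  exact f.summable_norm.le_tsum x fun _ _ => norm_nonneg _

end Space

section Convolution

variable {G : Type*} [Group G]

/-- The shear `(y, x) ↦ (y, y⁻¹ x)`. -/
def shear (G : Type*) [Group G] : G × G ≃ G × G where
  toFun p := (p.1, p.1⁻¹ * p.2)
  invFun p := (p.1, p.1 * p.2)
  left_inv p := by simp
  right_inv p := by simp

theorem summable_shear (f g : L1 G) : Summable fun p : G × G => ‖f p.1 * g (p.1⁻¹ * p.2)‖ := by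
  have h : Summable fun p : G × G => ‖f p.1‖ * ‖g p.2‖ :=
    f.summable_norm.mul_of_nonneg g.summable_norm (fun _ => norm_nonneg _) fun _ => norm_nonneg _
  simpa [Function.comp_def, shear] using (shear G).summable_iff.mpr h

theorem summable_shear' (f g : L1 G) :
    Summable fun p : G × G => ‖f p.2 * g (p.2⁻¹ * p.1)‖ :=
  (Equiv.prodComm G G).summable_iff.mpr (summable_shear f g)

theorem summable_conv (f g : L1 G) (x : G) : Summable fun y => ‖f y * g (y⁻¹ * x)‖ :=
  (summable_shear' f g).prod_factor x

theorem summable_norm_conv (f g : L1 G) : Summable fun x => ‖∑' y, f y * g (y⁻¹ * x)‖ :=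
  (summable_shear' f g).prod.of_nonneg_of_le (fun _ => norm_nonneg _)
    fun x => norm_tsum_le_tsum_norm (summable_conv f g x)

/-- Convolution: `(f * g)(x) = ∑_y f(y) g(y⁻¹ x)`. -/
instance : Mul (L1 G) where
  mul f g := mk (fun x => ∑' y, f y * g (y⁻¹ * x)) (summable_norm_conv f g)

theorem mul_apply (f g : L1 G) (x : G) : (f * g) x = ∑' y, f y * g (y⁻¹ * x) := rfl

open Classical in
/-- The identity element of `ℓ¹(G)` is the point mass at the identity of `G`. -/
instance : One (L1 G) where
  one := mk (fun x => if x = 1 then 1 else 0)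
    (summable_of_ne_finset_zero (s := {1}) fun x hx => by simp_all)

open Classical in
theorem one_apply (x : G) : (1 : L1 G) x = if x = 1 then 1 else 0 := rfl

theorem conv_assoc (f g h : L1 G) : f * g * h = f * (g * h) := by
  ext x
  have hs : Summable (Function.uncurry fun z y : G => f y * g (y⁻¹ * z) * h (z⁻¹ * x)) := by
    refine Summable.of_norm_bounded ((summable_shear' f g).mul_right ‖h‖) fun p => ?_
    obtain ⟨z, y⟩ := p
    rw [Function.uncurry_apply_pair, norm_mul]
    exact mul_le_mul_of_nonneg_left (norm_apply_le h _) (norm_nonneg _)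
  calc (f * g * h) x = ∑' z, ∑' y, f y * g (y⁻¹ * z) * h (z⁻¹ * x) := by
        simp only [mul_apply, tsum_mul_right]
    _ = ∑' y, ∑' z, f y * g (y⁻¹ * z) * h (z⁻¹ * x) := hs.tsum_comm.symm
    _ = ∑' y, f y * ∑' w, g w * h (w⁻¹ * (y⁻¹ * x)) := by
        refine tsum_congr fun y => ?_
        rw [← tsum_mul_left, ← (Equiv.mulLeft y).tsum_eq]
        refine tsum_congr fun w => ?_
        simp [mul_assoc]
    _ = (f * (g * h)) x := rfl

theorem norm_conv_le (f g : L1 G) : ‖f * g‖ ≤ ‖f‖ * ‖g‖ := by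
  calc ‖f * g‖ = ∑' x, ‖∑' y, f y * g (y⁻¹ * x)‖ := norm_eq _
    _ ≤ ∑' x, ∑' y, ‖f y * g (y⁻¹ * x)‖ :=
        (summable_norm_conv f g).tsum_le_tsum
          (fun x => norm_tsum_le_tsum_norm (summable_conv f g x)) (summable_shear' f g).prod
    _ = ∑' y, ∑' x, ‖f y * g (y⁻¹ * x)‖ :=
        Summable.tsum_comm (f := fun y x => ‖f y * g (y⁻¹ * x)‖) (summable_shear f g)
    _ = ∑' y, ‖f y‖ * ‖g‖ := by
        refine tsum_congr fun y => ?_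
        simp only [norm_mul, tsum_mul_left]
        rw [norm_eq g, ← (Equiv.mulLeft y⁻¹).tsum_eq fun x => ‖g x‖]
        rfl
    _ = ‖f‖ * ‖g‖ := by rw [tsum_mul_right, norm_eq f]

instance : Ring (L1 G) :=
  { (inferInstance : AddCommGroup (L1 G)), (inferInstance : Mul (L1 G)),
    (inferInstance : One (L1 G)) with
    left_distrib := fun f g h => by
      ext x
      simp only [mul_apply, add_apply, mul_add]
      exact (summable_conv f g x).of_norm.tsum_add (summable_conv f h x).of_norm
    right_distrib := fun f g h => by
      ext x
      simp only [mul_apply, add_apply, add_mul]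
      exact (summable_conv f h x).of_norm.tsum_add (summable_conv g h x).of_norm
    zero_mul := fun f => by ext x; simp [mul_apply]
    mul_zero := fun f => by ext x; simp [mul_apply]
    mul_assoc := conv_assoc
    one_mul := fun f => by
      ext x
      rw [mul_apply, tsum_eq_single 1 fun y hy => by simp [one_apply, hy]]
      simp [one_apply]
    mul_one := fun f => by
      ext x
      rw [mul_apply, tsum_eq_single x fun y hy => by
        rw [one_apply, if_neg (by rwa [inv_mul_eq_one]), mul_zero]]
      simp [one_apply] }

/-- `ℓ¹(G)` is a Banach algebra under convolution. -/
instance : NormedRing (L1 G) :=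
  { (inferInstance : NormedAddCommGroup (L1 G)), (inferInstance : Ring (L1 G)) with
    norm_mul_le := norm_conv_le }

instance : Algebra ℂ (L1 G) :=
  Algebra.ofModule
    (fun c f g => by
      ext x
      simp only [mul_apply, smul_apply, ← tsum_mul_left, mul_assoc])
    (fun c f g => by
      ext x
      simp only [mul_apply, smul_apply, ← tsum_mul_left, mul_left_comm])

instance : NormedAlgebra ℂ (L1 G) where
  norm_smul_le c f := (norm_smul c f).le

end Convolution

end

end L1

/-- `Zℓ¹(G)`: the centre of the convolution algebra `ℓ¹(G)`, with the `ℓ¹`-norm. -/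
noncomputable abbrev ZL1 (G : Type*) [Group G] : Subalgebra ℂ (L1 G) := Subalgebra.center ℂ (L1 G)

/-- The Gelfand spectrum of `Zℓ¹(G)`: its nonzero multiplicative (continuous) linear functionals. -/
abbrev SpZL1 (G : Type*) [Group G] : Type _ := WeakDual.characterSpace ℂ (ZL1 G)

/-- An FC group: every conjugacy class is finite. -/
class IsFCGroup (G : Type*) [Group G] : Prop where
  finite_conjugatesOf : ∀ x : G, (conjugatesOf x).Finite

noncomputable section

open Classical in
/-- The indicator function of the conjugacy class of `x`, as an element of `Zℓ¹(G)`. -/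
def classIndicator {G : Type*} [Group G] [IsFCGroup G] (x : G) : ZL1 G :=
  ⟨L1.mk (fun y => if IsConj x y then 1 else 0)
    (summable_of_ne_finset_zero (s := (IsFCGroup.finite_conjugatesOf x).toFinset) fun y hy => by
      have : ¬ IsConj x y := by simpa [conjugatesOf] using hy
      rw [if_neg this, norm_zero]), by
    rw [Subalgebra.mem_center_iff]
    intro g
    ext z
    rw [L1.mul_apply, L1.mul_apply,
      ← ((Equiv.inv G).trans (Equiv.mulLeft z)).tsum_eq (fun y => L1.mk _ _ y * g (y⁻¹ * z))]
    refine tsum_congr fun y => ?_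
    have h : IsConj (z * y⁻¹) (y⁻¹ * z) := isConj_iff.mpr ⟨y⁻¹, by group⟩
    have h' : IsConj x (z * y⁻¹) ↔ IsConj x (y⁻¹ * z) :=
      ⟨fun hx => hx.trans h, fun hx => hx.trans h.symm⟩
    simp only [L1.mk_apply, Equiv.trans_apply, Equiv.inv_apply, Equiv.coe_mulLeft, h', mul_inv_rev,
      inv_inv, inv_mul_cancel_right]
    exact mul_comm _ _⟩

/-- The class function `ω~ : G → ℂ` of an algebra character `ω` of `Zℓ¹(G)`, determined by
`ω(f) = ∑ x, f(x) ω~(x⁻¹)`: its value at `x` is the mean value `ω(1_C) / |C|` of `ω` over the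
conjugacy class `C` of `x⁻¹`. For finite `G` it is `χ / χ(1)`, if `ω` is the algebra character
`f ↦ ∑ x, f(x) χ(x⁻¹) / χ(1)` of an irreducible group character `χ`. -/
def SpZL1.toFun {G : Type*} [Group G] [IsFCGroup G] (ω : SpZL1 G) (x : G) : ℂ :=
  ω (classIndicator x⁻¹) / (Nat.card (conjugatesOf x⁻¹) : ℂ)

/-- `ω` belongs to `c₀`: its class function on the discrete group `G` vanishes at infinity. -/
def SpZL1.MemC0 {G : Type*} [Group G] [IsFCGroup G] (ω : SpZL1 G) : Prop :=
  Tendsto (SpZL1.toFun ω) cofinite (𝓝 0)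

end

/-- The ideal `J` has a bounded approximate identity: a net `(e)` (here, equivalently, a proper
filter) of elements of `J`, bounded in norm, with `e * a → a` and `a * e → a` for all `a ∈ J`. -/
def HasBAI {A : Type*} [NormedRing A] (J : Ideal A) : Prop :=
  ∃ l : Filter J, l.IsApproximateUnit ∧ ∃ M : ℝ, ∀ᶠ e : J in l, ‖(e : A)‖ ≤ M

/-- The restricted direct product `⨁ G_i` of a family of groups: the families `(x_i)` with
`x_i = 1` for all but finitely many `i`. -/
abbrev RDP {ι : Type*} (G : ι → Type*) [∀ i, Group (G i)] : Type _ :=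
  Πʳ i, [G i, (⊥ : Subgroup (G i))]

/-- A restricted direct product of finite groups is an FC group. -/
instance RDP.isFCGroup {ι : Type*} (G : ι → Type*) [∀ i, Group (G i)] [∀ i, Finite (G i)] :
    IsFCGroup (RDP G) where
  finite_conjugatesOf x := by
    have hx : {i | x i ≠ 1}.Finite := by
      have h := Filter.eventually_cofinite.mp x.2
      exact h.subset fun i hi h' => hi (Subgroup.mem_bot.mp h')
    have : Finite {i | x i ≠ 1} := hx.to_subtype
    refine Set.Finite.of_injOn (t := Set.univ)
      (f := fun (y : RDP G) (i : {i | x i ≠ 1}) => y i.1) (fun _ _ => Set.mem_univ _) ?_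
      Set.finite_univ
    intro y hy z hz hyz
    have key : ∀ w ∈ conjugatesOf x, ∀ i, x i = 1 → w i = 1 := by
      intro w hw i hi
      obtain ⟨c, rfl⟩ := isConj_iff.mp hw
      simp [hi]
    ext i
    by_cases hi : x i = 1
    · rw [key y hy i hi, key z hz i hi]
    · exact congrFun hyz ⟨i, hi⟩

/-! ### Point evaluations and central functions in `L1 G` -/

namespace L1

variable {G : Type*}

/-! Let `e` run through a bounded approximate identity of `ker ω` and put `u = 1 - e`, so that `ω u
= 1`. For a class sum `C`, the element `C - ω(C)·1` lies in the kernel, hence `C * u - ω(C) u → 0`;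
at the identity of `G` this says `u(x) - u(1) ω~(x) → 0`. Along an ultrafilter `u(1) → c`, so `u → c
ω~` pointwise. If `c = 0`, then `ω~ ∈ c₀` and boundedness of `u` make `ω u` small, contradicting `ω
u = 1`. So `c ≠ 0`, and Fatou puts `ω~` in `ℓ¹` (`SpZL1.summable_norm_toFun`).

On the other hand, the indicator of a finite normal subgroup `N` is `|N|` times an idempotent, so
`ω~` sums over `N` to `0` or `|N|`, and over `N \ {1}` to at least `1` in modulus when `N` is
nontrivial (`SpZL1.one_le_norm_sum_toFun`). Infinitely many factors of the product are nontrivial,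
and they meet pairwise only in `1`, so `ω~` cannot be summable. -/

theorem tendsto_apply {α : Type*} {l : Filter α} {f : α → L1 G} {g : L1 G}
    (h : Tendsto f l (𝓝 g)) (x : G) : Tendsto (fun a => f a x) l (𝓝 (g x)) := by
  rw [tendsto_iff_norm_sub_tendsto_zero] at h ⊢
  exact squeeze_zero (fun _ => norm_nonneg _) (fun a => norm_apply_le (f a - g) x) h

theorem sum_norm_le (f : L1 G) (s : Finset G) : ∑ x ∈ s, ‖f x‖ ≤ ‖f‖ := by
  rw [norm_eq]
  exact f.summable_norm.sum_le_tsum s fun _ _ => norm_nonneg _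

open Classical in
/-- The point mass at `a`. -/
noncomputable def single (a : G) : L1 G :=
  mk (fun x => if x = a then 1 else 0)
    (summable_of_ne_finset_zero (s := {a}) fun x hx => by simp_all)

variable [Group G]

theorem single_mul_apply (a : G) (f : L1 G) (x : G) : (single a * f) x = f (a⁻¹ * x) := by
  rw [mul_apply, tsum_eq_single a fun y hy => by simp [single, hy]]
  simp [single]

theorem mul_single_apply (a : G) (f : L1 G) (x : G) : (f * single a) x = f (x * a⁻¹) := by
  rw [mul_apply, tsum_eq_single (x * a⁻¹) fun y hy => by
    have : ¬ y⁻¹ * x = a := fun h => hy (by simp [← h])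
    simp [single, this]]
  simp [single]

/-- Commuting with point masses alone already forces a class function. -/
theorem mem_center_iff (f : L1 G) :
    f ∈ Subalgebra.center ℂ (L1 G) ↔ ∀ x y, f (x * y) = f (y * x) := by
  rw [Subalgebra.mem_center_iff]
  constructor
  · intro h x y
    have := congrArg (fun k : L1 G => k y) (h (single x⁻¹))
    simpa [single_mul_apply, mul_single_apply] using this
  · intro h g
    ext z
    rw [mul_apply, mul_apply,
      ← ((Equiv.inv G).trans (Equiv.mulLeft z)).tsum_eq (fun y => f y * g (y⁻¹ * z))]
    refine tsum_congr fun y => ?_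
    simp [h z y⁻¹, mul_comm]

end L1

/-! ### Indicators of subgroups and classes in the centre -/

namespace ZL1

variable {G : Type*} [Group G]

theorem apply_eq_of_isConj (f : ZL1 G) {x y : G} (h : IsConj x y) : f.1 x = f.1 y := by
  obtain ⟨c, rfl⟩ := isConj_iff.mp h
  rw [(L1.mem_center_iff _).mp f.2 (c * x) c⁻¹]
  simp

instance : CompleteSpace (ZL1 G) := by
  suffices h : IsClosed (ZL1 G : Set (L1 G)) from h.completeSpace_coe
  have : (ZL1 G : Set (L1 G)) = ⋂ g : L1 G, {f | g * f = f * g} := by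
    ext f
    rw [SetLike.mem_coe, Subalgebra.mem_center_iff, Set.mem_iInter]
    rfl
  rw [this]
  exact isClosed_iInter fun g =>
    isClosed_eq (continuous_const.mul continuous_id) (continuous_id.mul continuous_const)

open Classical in
/-- The indicator function of a finite normal subgroup, as a central element of `ℓ¹(G)`. -/
noncomputable def subgroupIndicator (N : Subgroup G) [N.Normal] [Finite N] : ZL1 G :=
  ⟨L1.mk (fun x => if x ∈ N then 1 else 0)
    (summable_of_ne_finset_zero (s := (Set.toFinite (N : Set G)).toFinset) fun x hx => by
      have : x ∉ N := by simpa using hx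
      simp [this]), by
    rw [L1.mem_center_iff]
    intro x y
    simp [Subgroup.Normal.mem_comm_iff ‹N.Normal› (a := x) (b := y)]⟩

open Classical in
theorem subgroupIndicator_apply (N : Subgroup G) [N.Normal] [Finite N] (x : G) :
    (subgroupIndicator N).1 x = if x ∈ N then 1 else 0 := rfl

open Classical in
theorem tsum_ite_mem (N : Subgroup G) [Finite N] (c : ℂ) :
    ∑' y, (if y ∈ N then c else 0) = Nat.card N * c := by
  rw [show (fun y => if y ∈ N then c else 0) = (N : Set G).indicator fun _ => c by
    ext y; simp [Set.indicator_apply], ← tsum_subtype, tsum_const, nsmul_eq_mul]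
  rfl

theorem subgroupIndicator_mul_self (N : Subgroup G) [N.Normal] [Finite N] :
    subgroupIndicator N * subgroupIndicator N = (Nat.card N : ℂ) • subgroupIndicator N := by
  classical
  ext x
  change _ = (Nat.card N : ℂ) * (subgroupIndicator N).1 x
  rw [← tsum_ite_mem]
  refine tsum_congr fun y => ?_
  simp only [subgroupIndicator_apply]
  by_cases h : y ∈ N
  · simp [h, N.mul_mem_cancel_left (N.inv_mem h)]
  · simp [h]

open Classical in
theorem tsum_ite_isConj (x : G) [Finite (conjugatesOf x)] (c : ℂ) :
    ∑' y, (if IsConj x y then c else 0) = Nat.card (conjugatesOf x) * c := by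
  rw [show (fun y => if IsConj x y then c else 0) = (conjugatesOf x).indicator fun _ => c by
    ext y; simp [Set.indicator_apply, conjugatesOf], ← tsum_subtype, tsum_const, nsmul_eq_mul]

section FC

variable [IsFCGroup G]

open Classical in
theorem classIndicator_apply (x y : G) :
    (classIndicator x).1 y = if IsConj x y then 1 else 0 := rfl

instance (x : G) : Finite (conjugatesOf x) := (IsFCGroup.finite_conjugatesOf x).to_subtype

theorem card_conjugatesOf_ne_zero (x : G) : (Nat.card (conjugatesOf x) : ℂ) ≠ 0 := by
  have : Nonempty (conjugatesOf x) := ⟨⟨x, IsConj.refl x⟩⟩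
  exact_mod_cast Nat.card_pos.ne'

theorem norm_classIndicator (x : G) : ‖classIndicator x‖ = Nat.card (conjugatesOf x) := by
  classical
  have h := tsum_ite_isConj x 1
  rw [mul_one] at h
  have h2 : ‖classIndicator x‖ = ∑' y, (if IsConj x y then (1 : ℝ) else 0) := by
    refine (L1.norm_eq _).trans (tsum_congr fun y => ?_)
    change ‖(classIndicator x).1 y‖ = _
    rw [classIndicator_apply]; split_ifs <;> simp
  rw [h2]
  have h3 : ((∑' y, (if IsConj x y then (1 : ℝ) else 0) : ℝ) : ℂ) = Nat.card (conjugatesOf x) := by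
    rw [← h, Complex.ofReal_tsum]
    exact tsum_congr fun y => by split_ifs <;> simp
  exact_mod_cast h3

/-- A central function is the sum of its values times the averaged class indicators. -/
theorem hasSum_classIndicator (f : ZL1 G) :
    HasSum (fun x => (f.1 x / Nat.card (conjugatesOf x)) • classIndicator x) f := by
  classical
  have hs : Summable fun x => (f.1 x / Nat.card (conjugatesOf x)) • classIndicator x := by
    -- Dividing by the class size makes the norm of the term at `x` exactly `‖f x‖`.
    refine Summable.of_norm ((L1.summable_norm f.1).congr fun x => ?_)
    rw [norm_smul, norm_classIndicator, norm_div, Complex.norm_natCast, div_mul_cancel₀]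
    exact_mod_cast card_conjugatesOf_ne_zero x
  convert hs.hasSum using 1
  ext z
  have hz : HasSum (fun x => (f.1 x / Nat.card (conjugatesOf x)) * (classIndicator x).1 z)
      ((∑' x, (f.1 x / Nat.card (conjugatesOf x)) • classIndicator x : ZL1 G).1 z) := by
    have := L1.tendsto_apply ((continuous_subtype_val.tendsto _).comp hs.hasSum) z
    refine this.congr fun s => ?_
    simp only [Function.comp_apply]
    induction s using Finset.induction_on with
    | empty => simp
    | insert a s ha ih => rw [Finset.sum_insert ha, Finset.sum_insert ha, ← ih]; rfl
  rw [← hz.tsum_eq]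
  have h2 : ∀ x, (f.1 x / Nat.card (conjugatesOf x)) * (classIndicator x).1 z =
      if IsConj z x then f.1 z / Nat.card (conjugatesOf z) else 0 := by
    intro x
    rw [classIndicator_apply]
    by_cases h : IsConj z x
    · rw [if_pos h, if_pos h.symm, apply_eq_of_isConj f h, h.conjugatesOf_eq, mul_one]
    · rw [if_neg h, if_neg fun h' => h h'.symm, mul_zero]
  simp_rw [h2]
  rw [tsum_ite_isConj, mul_div_cancel₀ _ (card_conjugatesOf_ne_zero z)]

/-- Evaluation at the identity sums `u` over the inverses of the class, where it is constant. This
recovers the values of `u` from its products with class sums. -/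
theorem classIndicator_mul_apply_one (x : G) (u : ZL1 G) :
    (classIndicator x * u).1 1 = Nat.card (conjugatesOf x) * u.1 x⁻¹ := by
  classical
  rw [← tsum_ite_isConj]
  refine tsum_congr fun y => ?_
  rw [classIndicator_apply, mul_one]
  split_ifs with h
  · rw [one_mul]
    obtain ⟨c, rfl⟩ := isConj_iff.mp h
    exact (apply_eq_of_isConj u (isConj_iff.mpr ⟨c, by group⟩)).symm
  · simp

end FC

end ZL1

/-- Turns the approximate-unit defect of `a - c` at `e` into an approximate eigenvector equation for
`1 - e`. -/
theorem sub_algebraMap_sub_mul {A : Type*} [Ring A] [Algebra ℂ A] (a e : A) (c : ℂ) :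
    (a - algebraMap ℂ A c) - (a - algebraMap ℂ A c) * e = a * (1 - e) - c • (1 - e) := by
  rw [Algebra.smul_def]
  noncomm_ring

/-! ### Class functions of characters -/

namespace SpZL1

variable {G : Type*} [Group G] [IsFCGroup G] (ω : SpZL1 G)

theorem hasSum_apply (f : ZL1 G) : HasSum (fun x => f.1 x * toFun ω x⁻¹) (ω f) := by
  have h := (ZL1.hasSum_classIndicator f).map ω (map_continuous ω)
  refine h.congr_fun fun x => ?_
  simp [toFun, div_mul_eq_mul_div, mul_div_assoc]

theorem toFun_one : toFun ω 1 = 1 := by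
  classical
  have h : classIndicator (1 : G) = 1 := by
    ext x
    change (classIndicator (1 : G)).1 x = (1 : L1 G) x
    rw [ZL1.classIndicator_apply, L1.one_apply]
    simp [eq_comm]
  have h3 : Nat.card (conjugatesOf (1 : G)) = 1 := by
    have h4 : conjugatesOf (1 : G) = {1} := by
      ext y; simp [conjugatesOf, eq_comm]
    simp [h4]
  simp [toFun, h, h3]

/-- Since `ω` is multiplicative, its value `1 + S` on the indicator of `N` is `0` or `|N|`; hence
`S` is `-1` or `|N| - 1 ≥ 1`. -/
theorem one_le_norm_sum_toFun (N : Subgroup G) [N.Normal] [Finite N] [Nontrivial N] :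
    1 ≤ ‖∑ x ∈ (Set.toFinite ((N : Set G) \ {1})).toFinset, toFun ω x⁻¹‖ := by
  classical
  set S := ∑ x ∈ (Set.toFinite ((N : Set G) \ {1})).toFinset, toFun ω x⁻¹ with hS
  have h1 : ω (ZL1.subgroupIndicator N) = 1 + S := by
    rw [← (hasSum_apply ω _).tsum_eq,
      tsum_eq_sum (s := insert 1 (Set.toFinite ((N : Set G) \ {1})).toFinset) fun x hx => ?_,
      Finset.sum_insert (by simp)]
    · rw [ZL1.subgroupIndicator_apply, if_pos N.one_mem, inv_one, toFun_one, one_mul, hS]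
      congr 1
      refine Finset.sum_congr rfl fun x hx => ?_
      have hx' : x ∈ N ∧ x ≠ 1 := by simpa using hx
      rw [ZL1.subgroupIndicator_apply, if_pos hx'.1, one_mul]
    · have hx' : x ≠ 1 ∧ (x ∈ N → x = 1) := by simpa using hx
      rw [ZL1.subgroupIndicator_apply, if_neg fun h => hx'.1 (hx'.2 h), zero_mul]
  have h2 : ω (ZL1.subgroupIndicator N) * ω (ZL1.subgroupIndicator N) =
      Nat.card N * ω (ZL1.subgroupIndicator N) := by
    rw [← map_mul, ZL1.subgroupIndicator_mul_self, map_smul, smul_eq_mul]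
  have hN : (2 : ℝ) ≤ Nat.card N := by exact_mod_cast Finite.one_lt_card
  rcases mul_eq_mul_right_iff.mp h2 with h | h
  · have : S = ((Nat.card N - 1 : ℝ) : ℂ) := by
      rw [h1] at h; push_cast; rw [← h]; ring
    rw [this, Complex.norm_real, Real.norm_eq_abs]
    exact le_abs.mpr (Or.inl (by linarith))
  · have : S = -1 := by rw [h1] at h; linear_combination h
    simp [this]

theorem norm_apply_le_of_forall_notMem (u : ZL1 G) (F : Finset G) {ε : ℝ} (hε : 0 ≤ ε)
    (hF : ∀ x ∉ F, ‖toFun ω x⁻¹‖ ≤ ε) :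
    ‖ω u‖ ≤ (∑ x ∈ F, ‖u.1 x‖ * ‖toFun ω x⁻¹‖) + ε * ‖u‖ := by
  classical
  have h1 : HasSum (fun x => (if x ∈ F then ‖u.1 x‖ * ‖toFun ω x⁻¹‖ else 0) + ε * ‖u.1 x‖)
      ((∑ x ∈ F, ‖u.1 x‖ * ‖toFun ω x⁻¹‖) + ε * ‖u‖) := by
    refine HasSum.add ?_ ?_
    · have := hasSum_sum_of_ne_finset_zero (s := F) (L := .unconditional G)
        (f := fun x => if x ∈ F then ‖u.1 x‖ * ‖toFun ω x⁻¹‖ else 0) fun x hx => if_neg hx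
      rwa [Finset.sum_congr rfl fun x hx => if_pos hx] at this
    · have := (L1.summable_norm u.1).hasSum.mul_left ε
      rwa [← L1.norm_eq] at this
  rw [← (hasSum_apply ω u).tsum_eq]
  refine tsum_of_norm_bounded h1 fun x => ?_
  rw [norm_mul]
  split_ifs with hx
  · exact le_add_of_nonneg_right (by positivity)
  · rw [zero_add, mul_comm]
    exact mul_le_mul_of_nonneg_right (hF x hx) (norm_nonneg _)

/-- If `ker ω` has a bounded approximate identity and `ω~` is in `c₀`, then `ω~` is summable. -/
theorem summable_norm_toFun (hω : HasBAI (RingHom.ker ω)) (h0 : MemC0 ω) :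
    Summable fun x => ‖toFun ω x‖ := by
  obtain ⟨l, hl, M, hM⟩ := hω
  have := hl.neBot
  -- An ultrafilter makes the bounded values `u(1)` converge without passing to subnets.
  let U : Ultrafilter (RingHom.ker ω) := Ultrafilter.of l
  have hU : (U : Filter (RingHom.ker ω)) ≤ l := Ultrafilter.of_le l
  let u : RingHom.ker ω → ZL1 G := fun e => 1 - e
  have hu1 : ∀ e, ω (u e) = 1 := fun e => by
    have he : ω (e : ZL1 G) = 0 := e.2
    simp [u, he]
  let K : ℝ := max (‖(1 : ZL1 G)‖ + M) 1
  have hK : 0 < K := lt_max_of_lt_right one_pos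
  have huK : ∀ᶠ e in (U : Filter (RingHom.ker ω)), ‖u e‖ ≤ K := by
    filter_upwards [hU hM] with e he
    exact (norm_sub_le _ _).trans (le_max_of_le_left (by gcongr))
  obtain ⟨c, -, hc⟩ := (isCompact_closedBall (0 : ℂ) K).ultrafilter_le_nhds
    (U.map fun e => (u e).1 1) (by
      rw [Filter.le_principal_iff]
      change ∀ᶠ e in (U : Filter (RingHom.ker ω)), (u e).1 1 ∈ Metric.closedBall 0 K
      filter_upwards [huK] with e he
      rw [mem_closedBall_zero_iff]
      exact (L1.norm_apply_le _ _).trans he)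
  have hc : Tendsto (fun e => (u e).1 1) U (𝓝 c) := hc
  have hux : ∀ x, Tendsto (fun e => (u e).1 x) U (𝓝 (c * toFun ω x)) := by
    intro x
    let C := classIndicator x⁻¹
    have hn := ZL1.card_conjugatesOf_ne_zero x⁻¹
    let a : RingHom.ker ω := ⟨C - algebraMap ℂ _ (ω C), by
      rw [RingHom.mem_ker, map_sub, AlgHomClass.commutes]; simp⟩
    have ht : Tendsto (fun e : RingHom.ker ω => (a * e : RingHom.ker ω)) U (𝓝 a) :=
      (hl.tendsto_mul_left a).mono_left hU
    have ht2 := L1.tendsto_apply ((continuous_subtype_val.tendsto _).comp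
      ((continuous_subtype_val.tendsto _).comp ht)) 1
    -- The last term is the defect `a - a * e` at the identity, divided by the class size; it tends
    -- to `0`.
    have hid : ∀ e, (u e).1 x = (u e).1 1 * toFun ω x +
        (a.1.1 1 - (a.1 * e.1).1 1) / Nat.card (conjugatesOf x⁻¹) := by
      intro e
      have h1 : a.1.1 1 - (a.1 * e.1).1 1 = (C * u e).1 1 - ω C * (u e).1 1 := by
        have : a.1 - a.1 * e.1 = C * u e - ω C • u e := sub_algebraMap_sub_mul C e.1 (ω C)
        exact congrArg (fun k : ZL1 G => k.1 1) this
      rw [h1, ZL1.classIndicator_mul_apply_one, inv_inv]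
      change _ = _ * (ω C / _) + _
      field_simp
      ring
    simp_rw [hid]
    have := (hc.mul_const (toFun ω x)).add
      (((tendsto_const_nhds (x := a.1.1 1)).sub ht2).div_const
        (Nat.card (conjugatesOf x⁻¹) : ℂ))
    simpa using this
  have hc0 : c ≠ 0 := by
    rintro rfl
    -- Chosen so that the tail contributes at most `ε * K = 1/2 < 1`.
    let ε : ℝ := 1 / (2 * K)
    have hε : 0 < ε := by positivity
    have hfin : {x : G | ¬ ‖toFun ω x⁻¹‖ ≤ ε}.Finite := by
      have h1 : Tendsto (fun x => ‖toFun ω x⁻¹‖) cofinite (𝓝 0) := by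
        simpa using (h0.comp (inv_injective (G := G)).tendsto_cofinite).norm
      exact (h1.eventually_le_const hε)
    have hlim : Tendsto
        (fun e => (∑ x ∈ hfin.toFinset, ‖(u e).1 x‖ * ‖toFun ω x⁻¹‖) + ε * K) U
        (𝓝 (0 + ε * K)) := by
      refine Tendsto.add_const _ ?_
      rw [← Finset.sum_const_zero (s := hfin.toFinset)]
      refine tendsto_finsetSum _ fun x _ => ?_
      simpa using (hux x).norm.mul_const ‖toFun ω x⁻¹‖
    have : (1 : ℝ) ≤ 0 + ε * K := by
      refine ge_of_tendsto hlim ?_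
      filter_upwards [huK] with e he
      have := norm_apply_le_of_forall_notMem ω (u e) hfin.toFinset hε.le
        fun x hx => by simpa using hx
      rw [hu1, norm_one] at this
      exact this.trans (by gcongr)
    have h2 : ε * K = 1 / 2 := by simp only [ε]; field_simp
    linarith
  -- Fatou: finite partial sums of `‖u‖` are at most `K` and converge to those of `‖c ω~‖`.
  refine summable_of_sum_le (c := K / ‖c‖) (fun _ => norm_nonneg _) fun s => ?_
  rw [le_div_iff₀ (norm_pos_iff.mpr hc0), Finset.sum_mul]
  have hlim : Tendsto (fun e => ∑ x ∈ s, ‖(u e).1 x‖) U (𝓝 (∑ x ∈ s, ‖toFun ω x‖ * ‖c‖)) := by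
    refine tendsto_finsetSum _ fun x _ => ?_
    simpa [mul_comm] using (hux x).norm
  refine le_of_tendsto hlim ?_
  filter_upwards [huK] with e he
  exact (L1.sum_norm_le _ s).trans he

end SpZL1

/-! ### Factors of the restricted direct product -/

namespace RDP

variable {ι : Type*} (G : ι → Type*) [∀ i, Group (G i)]

/-- The `i`-th factor of a restricted direct product, as a subgroup. -/
def factor (i : ι) : Subgroup (RDP G) where
  carrier := {x | ∀ j, j ≠ i → x j = 1}
  mul_mem' hx hy j hj := by simp [hx j hj, hy j hj]
  one_mem' j _ := rfl
  inv_mem' hx j hj := by simp [hx j hj]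

variable {G} in
theorem mem_factor {i : ι} {x : RDP G} : x ∈ factor G i ↔ ∀ j, j ≠ i → x j = 1 := Iff.rfl

instance (i : ι) : (factor G i).Normal where
  conj_mem x hx c := mem_factor.mpr fun j hj => by simp [mem_factor.mp hx j hj]

variable {G} in
theorem eq_one_of_mem_factor {i : ι} {x : RDP G} (hx : x ∈ factor G i) (h : x i = 1) : x = 1 := by
  ext j
  by_cases hj : j = i
  · subst hj; exact h
  · exact hx j hj

instance (i : ι) [Finite (G i)] : Finite (factor G i) := by
  refine Finite.of_injective (fun x : factor G i => x.1 i) fun x y hxy => Subtype.ext ?_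
  ext j
  by_cases hj : j = i
  · subst hj; exact hxy
  · rw [x.2 j hj, y.2 j hj]

instance (i : ι) [Nontrivial (G i)] : Nontrivial (factor G i) := by
  classical
  obtain ⟨g, hg⟩ := exists_ne (1 : G i)
  refine ⟨⟨⟨RestrictedProduct.mulSingle _ i g, fun j hj => ?_⟩, 1, fun h => hg ?_⟩⟩
  · exact RestrictedProduct.mulSingle_eq_of_ne _ _ hj
  · exact (RestrictedProduct.mulSingle_eq_one_iff _ _).mp (congrArg Subtype.val h)

theorem finite_support (x : RDP G) : {i | x i ≠ 1}.Finite :=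
  (Filter.eventually_cofinite.mp x.2).subset fun _ hi h' => hi (Subgroup.mem_bot.mp h')

theorem infinite_setOf_nontrivial [∀ i, Finite (G i)] [Infinite (RDP G)] :
    {i | Nontrivial (G i)}.Infinite := by
  intro h
  have := h.to_subtype
  refine not_finite_iff_infinite.mpr ‹Infinite (RDP G)› (Finite.of_injective
    (fun (x : RDP G) (i : {i | Nontrivial (G i)}) => x i.1) fun x y hxy => ?_)
  ext i
  by_cases hi : Nontrivial (G i)
  · exact congrFun hxy ⟨i, hi⟩
  · have := not_nontrivial_iff_subsingleton.mp hi
    exact Subsingleton.elim _ _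

end RDP

theorem theoremt {ι : Type*} (G : ι → Type*) [∀ i, Group (G i)] [∀ i, Finite (G i)]
    [Infinite (RDP G)] (ω : SpZL1 (RDP G)) (hω : HasBAI (RingHom.ker ω)) :
    ¬ SpZL1.MemC0 ω := by
  classical
  intro h0
  have hs : Summable fun x => SpZL1.toFun ω x⁻¹ :=
    ((Equiv.inv (RDP G)).summable_iff.mpr (SpZL1.summable_norm_toFun ω hω h0)).of_norm
  obtain ⟨F, hF⟩ := summable_iff_vanishing_norm.mp hs 1 one_pos
  -- A nontrivial factor outside the supports of all elements of `F` meets `F` at most in `1`, so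
  -- the Cauchy criterion bounds its sum strictly below `1`.
  obtain ⟨i, hi, hiF⟩ := (RDP.infinite_setOf_nontrivial G).exists_notMem_finset
    (F.biUnion fun x => (RDP.finite_support G x).toFinset)
  have : Nontrivial (G i) := hi
  refine (hF _ ?_).not_ge (SpZL1.one_le_norm_sum_toFun ω (RDP.factor G i))
  rw [Finset.disjoint_left]
  intro x hx hxF
  have hx' : x ∈ RDP.factor G i ∧ x ≠ 1 := by simpa using hx
  refine hx'.2 (RDP.eq_one_of_mem_factor hx'.1 ?_)
  by_contra h
  exact hiF (Finset.mem_biUnion.mpr ⟨x, hxF, by simpa using h⟩)
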